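/- For a group $G$, let $\Gamma(G)$ be the graph whose vertices are the non-trivial proper subgroups of $G$, two distinct vertices $H,K$ being adjacent if and only if $HK=G$. Let $\Gamma^*(G)$ be the graph obtained from $\Gamma(G)$ by removing its isolated vertices. A universal vertex of a graph is a vertex adjacent to all other vertices. Let $\Phi(G)$ denote the Frattini subgroup (the intersection of all maximal subgroups of $G$), and let $\iota(G)$ denote the minimum number of maximal subgroups of $G$ whose intersection is $\Phi(G)$. **Theorem.** Let $G$ be a finite nilpotent group. (A) $\Gamma^*(G)$ has a universal vertex if and only if $G$ is isomorphic to one of the following groups: 1. $\mathbb{Z}_{pq}$, where $p,q$ are distinct primes; 2. $\mathbb{Z}_{p^aq}$, where $p,q$ are distinct primes and $a\ge 2$; 3. $\mathbb{Z}_{p^{n-1}}\times\mathbb{Z}_p$, where $p$ is a prime and $n\ge 2$; 4. $M_{p^n}=\langle a,b : a^{p^{n-1}}=b^p=e,\ b^{-1}ab=a^{1+p^{n-2}}\rangle$, where $p$ is a prime, $n\ge 3$, and $n\ge 4$ if $p=2$; 5. the dihedral group $\langle a,b : a^{2^{n-1}}=b^2=e,\ bab=a^{-1}\rangle$ of order $2^n$,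 $n\ge 3$; 6. the generalized quaternion group $Q_{2^n}=\langle a,b : a^{2^{n-1}}=e,\ b^2=a^{2^{n-2}},\ b^{-1}ab=a^{-1}\rangle$, $n\ge 3$; 7. the semidihedral group $SD_{2^n}=\langle a,b : a^{2^{n-1}}=b^2=e,\ bab=a^{-1+2^{n-2}}\rangle$, $n\ge 4$. (B) If $H$ is a universal vertex of $\Gamma^*(G)$, then $H$ is a cyclic maximal subgroup of $G$, $H\cap K=\Phi(G)$ for every maximal subgroup $K\ne H$ of $G$, and $\iota(G)=2$. -/

import Mathlib

open scoped Pointwise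

/-- The co-maximal subgroup graph `Γ(G)`: its vertices are the nontrivial proper subgroups of `G`,
and two distinct vertices `H`, `K` are adjacent iff `HK = G` (a product of subsets of `G`). -/
def comaximalGraph (G : Type*) [Group G] :
    SimpleGraph {H : Subgroup G // H ≠ ⊥ ∧ H ≠ ⊤} where
  Adj H K := H ≠ K ∧ (H.1 : Set G) * (K.1 : Set G) = Set.univ
  symm := ⟨fun H K h => ⟨h.1.symm, by
    have h2 := congrArg (fun s : Set G => s⁻¹) h.2
    simpa [mul_inv_rev] using h2⟩⟩
  loopless := ⟨fun _ h => h.1 rfl⟩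

/-- The deleted co-maximal subgroup graph `Γ*(G)`: the isolated vertices of `Γ(G)` are removed. -/
def deletedComaximalGraph (G : Type*) [Group G] :
    SimpleGraph {v : {H : Subgroup G // H ≠ ⊥ ∧ H ≠ ⊤} // ¬ (comaximalGraph G).IsIsolated v} :=
  (comaximalGraph G).induce {v | ¬ (comaximalGraph G).IsIsolated v}

/-- The intersection number `ι(G)`: the least number of maximal subgroups of `G` whose
intersection is the Frattini subgroup. -/
noncomputable def intersectionNumber (G : Type*) [Group G] : ℕ :=
  sInf {k | ∃ S : Finset (Subgroup G),
    S.card = k ∧ (∀ M ∈ S, IsCoatom M) ∧ sInf (S : Set (Subgroup G)) = frattini G}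

/-- The group `M_{p^n} = ⟨a, b | a^(p^(n-1)) = b^p = 1, b⁻¹ a b = a^(1 + p^(n-2))⟩`
(with `a` the generator `0` and `b` the generator `1`); meant for `n ≥ 3`. -/
abbrev ModularPGroup (p n : ℕ) : Type :=
  PresentedGroup
    ({FreeGroup.of 0 ^ p ^ (n - 1),
      FreeGroup.of 1 ^ p,
      (FreeGroup.of 1)⁻¹ * FreeGroup.of 0 * FreeGroup.of 1 *
        (FreeGroup.of 0 ^ (1 + p ^ (n - 2)))⁻¹} : Set (FreeGroup (Fin 2)))

/-- The semidihedral group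
`SD_{2^n} = ⟨a, b | a^(2^(n-1)) = b^2 = 1, b a b = a^(-1 + 2^(n-2))⟩`
(with `a` the generator `0` and `b` the generator `1`); meant for `n ≥ 4`. -/
abbrev SemidihedralGroup (n : ℕ) : Type :=
  PresentedGroup
    ({FreeGroup.of 0 ^ 2 ^ (n - 1),
      FreeGroup.of 1 ^ 2,
      FreeGroup.of 1 * FreeGroup.of 0 * FreeGroup.of 1 *
        (FreeGroup.of 0 ^ (-1 + 2 ^ (n - 2) : ℤ))⁻¹} : Set (FreeGroup (Fin 2)))

/-! ### Universal vertices and cyclic maximal subgroups of prime power order. -/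

section Universal

variable {G : Type*} [Group G]

/-! In a finite nilpotent group maximal subgroups are normal of prime index, so a maximal `H`
satisfies `HK = G` as soon as `K` is not contained in `H`. A universal vertex `H` must be maximal:
otherwise a maximal subgroup above `H` would be a non-isolated vertex not adjacent to it. Likewise a
proper subgroup `L` of `H` outside `Φ(G)` misses some maximal `K`, so `LK = G` and `L` is not
isolated, yet `HL = H`. Hence every proper subgroup of `H` lies in `Φ(G)`. So any element of `H`
outside `Φ(G)` generates `H`, its order is a prime power, and (B) follows. Conversely, let `⟨h⟩` be
maximal of order `p ^ k > 1`, and not the only maximal subgroup. Its proper subgroups lie in `⟨h ^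
p⟩ ≤ Φ(G)`, hence are isolated, and every other subgroup is adjacent to it. Thus (A) amounts to
classifying the groups with `HasCyclicMaximalSubgroup`. Let `q` be the index of such an `⟨a⟩`. If `q
≠ p`, then `G` is cyclic of order `p ^ k * q`. If `q = p`, then `G` is a non-cyclic `p`-group
generated by `a` and `b` with `a * b = b * a ^ r` and `b ^ p ∈ ⟨a⟩`. Congruences for `r` leave few
cases, and in each one `b` is adjusted until the defining relations of a listed group hold
(`nonempty_mulEquiv_of_isCoatom_zpowers`). -/

/-- `G` has two maximal subgroups, one of which is cyclic of order a nontrivial prime power. -/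
def HasCyclicMaximalSubgroup (G : Type*) [Group G] : Prop :=
  ∃ (h : G) (p k : ℕ), p.Prime ∧ orderOf h = p ^ k ∧ h ≠ 1 ∧ IsCoatom (Subgroup.zpowers h) ∧
    ∃ M : Subgroup G, IsCoatom M ∧ M ≠ Subgroup.zpowers h

theorem Subgroup.mul_ne_univ_of_le {H K M : Subgroup G} (hM : M ≠ ⊤) (hH : H ≤ M) (hK : K ≤ M) :
    (H : Set G) * (K : Set G) ≠ Set.univ := by
  intro h
  apply hM
  rw [eq_top_iff]
  intro g _
  have hg : g ∈ (H : Set G) * (K : Set G) := h ▸ Set.mem_univ g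
  obtain ⟨x, hx, y, hy, rfl⟩ := hg
  exact M.mul_mem (hH hx) (hK hy)

theorem IsCoatom.normal_of_isNilpotent [Group.IsNilpotent G] {H : Subgroup G} (hH : IsCoatom H) :
    H.Normal :=
  Subgroup.NormalizerCondition.normal_of_coatom H Group.normalizerCondition_of_isNilpotent hH

theorem IsCoatom.mul_eq_univ [Group.IsNilpotent G] {H K : Subgroup G} (hH : IsCoatom H)
    (hK : ¬ K ≤ H) : (H : Set G) * (K : Set G) = Set.univ := by
  have := hH.normal_of_isNilpotent
  rw [← Subgroup.normal_mul, hH.2 (H ⊔ K) (left_lt_sup.2 hK), Subgroup.coe_top]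

theorem IsCoatom.ne_bot_of_exists_ne {α : Type*} [Lattice α] [BoundedOrder α] {M N : α}
    (hM : IsCoatom M) (hN : IsCoatom N) (h : M ≠ N) (hN' : N ≠ ⊥) : M ≠ ⊥ := by
  rintro rfl
  exact hN.1 (hM.2 N (bot_lt_iff_ne_bot.2 hN'))

/-- An element of prime order in `G ⧸ H` generates a subgroup whose preimage properly contains `H`,
so it generates the whole quotient. -/
theorem IsCoatom.index_prime [Finite G] [Group.IsNilpotent G] {H : Subgroup G} (hH : IsCoatom H) :
    H.index.Prime := by
  have hn := hH.normal_of_isNilpotent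
  have hne : H.index ≠ 1 := fun h => hH.1 (Subgroup.index_eq_one.1 h)
  have hp := Nat.minFac_prime hne
  have : Fact (Nat.minFac H.index).Prime := ⟨hp⟩
  obtain ⟨x, hx⟩ := exists_prime_orderOf_dvd_card' (G := G ⧸ H) _
    (show H.index.minFac ∣ Nat.card (G ⧸ H) from Nat.minFac_dvd _)
  have hcomap : (Subgroup.zpowers x).comap (QuotientGroup.mk' H) = ⊤ := by
    apply hH.2
    refine lt_of_le_of_ne ?_ ?_
    · intro g hg
      have : (QuotientGroup.mk' H) g = 1 := (QuotientGroup.eq_one_iff g).2 hg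
      simp only [Subgroup.mem_comap, this, one_mem]
    · intro h
      obtain ⟨g, rfl⟩ := QuotientGroup.mk'_surjective H x
      have hg : g ∈ H := by
        rw [h]; exact Subgroup.mem_zpowers _
      have : (QuotientGroup.mk' H) g = 1 := (QuotientGroup.eq_one_iff g).2 hg
      rw [this, orderOf_one] at hx
      exact hp.one_lt.ne hx
  have htop : Subgroup.zpowers x = ⊤ := by
    rw [eq_top_iff]
    intro y _
    obtain ⟨g, rfl⟩ := QuotientGroup.mk'_surjective H y
    have : g ∈ (Subgroup.zpowers x).comap (QuotientGroup.mk' H) := hcomap ▸ Subgroup.mem_top g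
    exact this
  have hcard : Nat.card (G ⧸ H) = H.index.minFac := by
    rw [← hx, ← Nat.card_zpowers, htop, Subgroup.card_top]
  have : H.index = H.index.minFac := hcard
  rw [this]; exact hp

theorem comaximalGraph_not_isIsolated_iff {v : {H : Subgroup G // H ≠ ⊥ ∧ H ≠ ⊤}} :
    ¬ (comaximalGraph G).IsIsolated v ↔
      ∃ w : {H : Subgroup G // H ≠ ⊥ ∧ H ≠ ⊤}, v ≠ w ∧
        (v.1 : Set G) * (w.1 : Set G) = Set.univ := by
  simp only [SimpleGraph.IsIsolated, not_forall, not_not]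
  rfl

theorem le_frattini_of_forall {L : Subgroup G} (h : ∀ K, IsCoatom K → L ≤ K) :
    L ≤ frattini G :=
  le_iInf₂ h

/-- For two distinct primes `d`, `e` dividing the order, `x ^ d` and `x ^ e` generate proper
subgroups and so lie in `F`; Bézout then puts `x` in `F`. -/
theorem exists_prime_pow_orderOf_of_forall_lt [Finite G] {x : G} {F : Subgroup G} (hx : x ∉ F)
    (h : ∀ L : Subgroup G, L < Subgroup.zpowers x → L ≤ F) :
    ∃ p k : ℕ, p.Prime ∧ orderOf x = p ^ k := by
  have hx1 : orderOf x ≠ 1 := fun h1 => hx (by rw [orderOf_eq_one_iff.1 h1]; exact one_mem F)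
  have key : ∀ d : ℕ, d.Prime → d ∣ orderOf x → x ^ d ∈ F := by
    intro d hd hdx
    apply h _ _ (Subgroup.mem_zpowers (x ^ d))
    refine lt_of_le_of_ne (Subgroup.zpowers_le.2 (Subgroup.npow_mem_zpowers x d)) fun heq => ?_
    have h1 := congrArg (fun K : Subgroup G => Nat.card K) heq
    simp only [Nat.card_zpowers] at h1
    rw [orderOf_pow_of_dvd hd.ne_zero hdx] at h1
    exact (Nat.div_lt_self (orderOf_pos x) hd.one_lt).ne h1
  refine ⟨(orderOf x).minFac, _, Nat.minFac_prime hx1,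
    Nat.eq_prime_pow_of_unique_prime_dvd (orderOf_pos x).ne' fun {d} hd hdx => ?_⟩
  by_contra hne
  have hcop : Nat.Coprime d (orderOf x).minFac :=
    (Nat.coprime_primes hd (Nat.minFac_prime hx1)).2 hne
  obtain ⟨u, v, huv⟩ := Nat.isCoprime_iff_coprime.2 hcop
  apply hx
  have : x = (x ^ d) ^ u * (x ^ (orderOf x).minFac) ^ v := by
    rw [← zpow_natCast, ← zpow_natCast, ← zpow_mul, ← zpow_mul, ← zpow_add, mul_comm (d : ℤ),
      mul_comm _ v, huv, zpow_one]
  rw [this]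
  exact F.mul_mem (F.zpow_mem (key d hd hdx) u)
    (F.zpow_mem (key _ (Nat.minFac_prime hx1) (Nat.minFac_dvd _)) v)

variable [Finite G] [Group.IsNilpotent G]

theorem SimpleGraph.IsUniversal.isCoatom_and {H} (hH : (deletedComaximalGraph G).IsUniversal H) :
    IsCoatom H.1.1 ∧ (∃ M : Subgroup G, IsCoatom M ∧ M ≠ H.1.1) ∧
      ∀ L : Subgroup G, L < H.1.1 → L ≤ frattini G := by
  obtain ⟨⟨H, hbot, htop⟩, hiso⟩ := H
  have hadj : ∀ K : Subgroup G, ∀ hK : K ≠ ⊥ ∧ K ≠ ⊤, K ≠ H →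
      (∃ L : Subgroup G, L ≠ ⊥ ∧ L ≠ ⊤ ∧ K ≠ L ∧ (K : Set G) * (L : Set G) = Set.univ) →
      (H : Set G) * (K : Set G) = Set.univ := by
    rintro K hK hne ⟨L, h1, h2, h3, h4⟩
    have hKiso : ¬ (comaximalGraph G).IsIsolated ⟨K, hK⟩ :=
      comaximalGraph_not_isIsolated_iff.2 ⟨⟨L, h1, h2⟩, fun h => h3 (congrArg Subtype.val h), h4⟩
    have := @hH ⟨⟨K, hK⟩, hKiso⟩ (fun h => hne
      (congrArg (fun v => v.1.1) h).symm)
    exact this.2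
  obtain ⟨⟨w, hwb, hwt⟩, -, hw⟩ := comaximalGraph_not_isIsolated_iff.1 hiso
  dsimp only at hw ⊢
  obtain ⟨M, hM, hwM⟩ := (eq_top_or_exists_le_coatom w).resolve_left hwt
  obtain ⟨N, hN, hHN⟩ := (eq_top_or_exists_le_coatom H).resolve_left htop
  have hNM : N ≠ M := by
    rintro rfl
    exact Subgroup.mul_ne_univ_of_le hN.1 hHN hwM hw
  have hMb : M ≠ ⊥ := ne_bot_of_le_ne_bot hwb hwM
  have hNb : N ≠ ⊥ := ne_bot_of_le_ne_bot hbot hHN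
  have hNH : N = H := by
    by_contra hne
    refine Subgroup.mul_ne_univ_of_le hN.1 hHN le_rfl
      (hadj N ⟨hNb, hN.1⟩ hne ⟨M, hMb, hM.1, hNM, hN.mul_eq_univ ?_⟩)
    intro hle
    exact hNM ((hM.le_iff_eq hN.1).1 hle)
  subst hNH
  refine ⟨hN, ⟨M, hM, hNM.symm⟩, fun L hL => ?_⟩
  by_contra hLF
  obtain ⟨K, hK, hLK⟩ : ∃ K, IsCoatom K ∧ ¬ L ≤ K := by
    by_contra! hcon
    exact hLF (le_frattini_of_forall hcon)
  have hLb : L ≠ ⊥ := by rintro rfl; exact hLK bot_le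
  have hLt : L ≠ ⊤ := hL.ne_top
  have hKN : K ≠ N := by rintro rfl; exact hLK hL.le
  have hKb := hK.ne_bot_of_exists_ne hN hKN hNb
  have hLKu : (L : Set G) * (K : Set G) = Set.univ := by
    have := hK.normal_of_isNilpotent
    rw [← Subgroup.mul_normal, sup_comm, hK.2 _ (left_lt_sup.2 hLK), Subgroup.coe_top]
  exact Subgroup.mul_ne_univ_of_le hN.1 le_rfl hL.le
    (hadj L ⟨hLb, hLt⟩ hL.ne ⟨K, hKb, hK.1, fun h => hLK h.le, hLKu⟩)

theorem SimpleGraph.IsUniversal.frattini_lt {H}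
    (hH : (deletedComaximalGraph G).IsUniversal H) : frattini G < H.1.1 := by
  obtain ⟨hc, ⟨M, hM, hne⟩, -⟩ := hH.isCoatom_and
  refine lt_of_le_of_ne (frattini_le_coatom hc) fun h => hne ?_
  exact (hc.le_iff_eq hM.1).1 (h ▸ frattini_le_coatom hM)

theorem SimpleGraph.IsUniversal.exists_zpowers_eq {H}
    (hH : (deletedComaximalGraph G).IsUniversal H) :
    ∃ x : G, Subgroup.zpowers x = H.1.1 ∧ x ∉ frattini G := by
  obtain ⟨x, hxH, hx⟩ := SetLike.exists_of_lt hH.frattini_lt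
  refine ⟨x, ?_, hx⟩
  by_contra hne
  exact hx (hH.isCoatom_and.2.2 _ (lt_of_le_of_ne (Subgroup.zpowers_le.2 hxH) hne)
    (Subgroup.mem_zpowers x))

theorem SimpleGraph.IsUniversal.hasCyclicMaximalSubgroup {H}
    (hH : (deletedComaximalGraph G).IsUniversal H) : HasCyclicMaximalSubgroup G := by
  obtain ⟨hc, hM, hF⟩ := hH.isCoatom_and
  obtain ⟨x, hx, hxF⟩ := hH.exists_zpowers_eq
  rw [← hx] at hc hM hF
  obtain ⟨p, k, hp, hk⟩ := exists_prime_pow_orderOf_of_forall_lt hxF hF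
  exact ⟨x, p, k, hp, hk, fun h => hxF (h ▸ one_mem _), hc, hM⟩

theorem SimpleGraph.IsUniversal.inf_eq_frattini {H}
    (hH : (deletedComaximalGraph G).IsUniversal H) {K : Subgroup G} (hK : IsCoatom K)
    (hne : K ≠ H.1.1) : H.1.1 ⊓ K = frattini G := by
  obtain ⟨hc, -, hF⟩ := hH.isCoatom_and
  refine le_antisymm (hF _ (inf_lt_left.2 fun hle => hne ?_))
    (le_inf (frattini_le_coatom hc) (frattini_le_coatom hK))
  exact (hc.le_iff_eq hK.1).1 hle

theorem SimpleGraph.IsUniversal.intersectionNumber_eq {H}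
    (hH : (deletedComaximalGraph G).IsUniversal H) : intersectionNumber G = 2 := by
  classical
  obtain ⟨hc, ⟨M, hM, hne⟩, -⟩ := hH.isCoatom_and
  have hlt := hH.frattini_lt
  apply le_antisymm
  · refine Nat.sInf_le ⟨{H.1.1, M}, Finset.card_pair hne.symm, ?_, ?_⟩
    · simp [hc, hM]
    · simpa using hH.inf_eq_frattini hM hne
  -- In `ℕ` the infimum of the empty set is `0`, so the lower bound needs a family that realizes
  -- `Φ(G)`.
  · refine le_csInf ⟨2, {H.1.1, M}, Finset.card_pair hne.symm, ?_, ?_⟩ ?_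
    · simp [hc, hM]
    · simpa using hH.inf_eq_frattini hM hne
    · rintro k ⟨S, rfl, hS, hSF⟩
      by_contra! hlt2
      have h01 : S.card ≤ 1 := by omega
      rcases Finset.card_le_one_iff_subset_singleton.1 h01 with ⟨K, hK⟩
      rcases Finset.subset_singleton_iff.1 hK with rfl | rfl
      -- The empty family has intersection `G`; a single maximal `K` would equal `Φ(G)`, which is
      -- properly contained in the maximal `H`.
      · rw [Finset.coe_empty, sInf_empty] at hSF
        exact hlt.ne_top hSF.symm
      · rw [Finset.coe_singleton, sInf_singleton] at hSF
        have hKc := hS K (Finset.mem_singleton_self K)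
        exact hc.1 (hKc.2 _ (hSF ▸ hlt))

theorem HasCyclicMaximalSubgroup.exists_isUniversal (hG : HasCyclicMaximalSubgroup G) :
    ∃ H, (deletedComaximalGraph G).IsUniversal H := by
  obtain ⟨h, p, k, hp, hk, h1, hc, M, hM, hne⟩ := hG
  have hb : Subgroup.zpowers h ≠ ⊥ := fun hb => h1 (Subgroup.zpowers_eq_bot.1 hb)
  have hMb := hM.ne_bot_of_exists_ne hc hne hb
  have hiso : ¬ (comaximalGraph G).IsIsolated ⟨Subgroup.zpowers h, hb, hc.1⟩ :=
    comaximalGraph_not_isIsolated_iff.2 ⟨⟨M, hMb, hM.1⟩,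
      fun he => hne (congrArg Subtype.val he).symm,
      hc.mul_eq_univ fun hle => hne ((hM.le_iff_eq hc.1).1 hle).symm⟩
  refine ⟨⟨_, hiso⟩, ?_⟩
  rintro ⟨⟨K, hKb, hKt⟩, hK⟩ hKne
  have hKne' : Subgroup.zpowers h ≠ K := by
    rintro rfl; exact hKne rfl
  refine ⟨fun he => hKne' (congrArg Subtype.val he), hc.mul_eq_univ fun hle => ?_⟩
  have hKF : K ≤ frattini G := by
    refine le_frattini_of_forall fun N hN => ?_
    by_cases hNh : N = Subgroup.zpowers h
    · exact hNh ▸ hle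
    have hNn := hN.normal_of_isNilpotent
    have hhN : h ∉ N := fun hh =>
      hNh (((hc.le_iff_eq hN.1).1 (Subgroup.zpowers_le.2 hh)))
    have hcase : ∀ m : ℕ, Nat.Coprime m p → h ^ m ∈ N → h ∈ N := by
      intro m hm hmN
      have hm' : Nat.Coprime m (p ^ k) := hm.pow_right k
      obtain ⟨u, v, huv⟩ := Nat.isCoprime_iff_coprime.2 hm'
      have : h = (h ^ m) ^ u := by
        conv_lhs => rw [← zpow_one h, ← huv, ← hk, zpow_add, zpow_mul' h v, zpow_natCast,
          pow_orderOf_eq_one, one_zpow, mul_one, mul_comm u, zpow_mul, zpow_natCast]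
      rw [this]; exact N.zpow_mem hmN u
    -- `h` to the power of the index of `N` lies in `N`; a prime index other than `p` would already
    -- give `h ∈ N`.
    have hpN : h ^ p ∈ N := by
      have hq := hN.index_prime
      have hqN := N.pow_index_mem h
      by_cases hqp : N.index = p
      · rwa [hqp] at hqN
      · exact absurd (hcase _ ((Nat.coprime_primes hq hp).2 hqp) hqN) hhN
    intro x hx
    obtain ⟨i, rfl⟩ := Subgroup.mem_zpowers_iff.1 (hle hx)
    by_cases hpi : (p : ℤ) ∣ i
    · obtain ⟨j, rfl⟩ := hpi
      rw [zpow_mul, zpow_natCast]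
      exact N.zpow_mem hpN j
    · exfalso
      have hcop : IsCoprime i ((p : ℤ) ^ k) :=
        (((Nat.prime_iff_prime_int.1 hp).coprime_iff_not_dvd.2 hpi).symm).pow_right
      obtain ⟨u, v, huv⟩ := hcop
      have : h = (h ^ i) ^ u := by
        conv_lhs => rw [← zpow_one h, ← huv, ← Nat.cast_pow, ← hk, zpow_add, zpow_mul' h v,
          zpow_natCast, pow_orderOf_eq_one, one_zpow, mul_one, mul_comm u, zpow_mul]
      have hmem : h ∈ K := by rw [this]; exact K.zpow_mem hx u
      exact hKne' (le_antisymm (Subgroup.zpowers_le.2 hmem) hle)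
  -- Elements of `Φ(G)` are non-generators, so a subgroup of `Φ(G)` has no neighbour.
  obtain ⟨⟨w, hwb, hwt⟩, -, hw⟩ := comaximalGraph_not_isIsolated_iff.1 hK
  apply hwt
  apply frattini_nongenerating
  by_contra htop
  exact Subgroup.mul_ne_univ_of_le htop (hKF.trans le_sup_right) le_sup_left hw

end Universal

/-! ### Groups generated by `x`, `y` with `x * y = y * x ^ r`. -/

section Generators

variable {G : Type*} [Group G]

theorem zpow_mul_pow_of_mul_eq {a b : G} {r : ℤ} (h : a * b = b * a ^ r) (i : ℤ) (k : ℕ) :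
    a ^ i * b ^ k = b ^ k * a ^ (r ^ k * i) := by
  have h1 : ∀ i : ℤ, a ^ i * b = b * a ^ (r * i) := by
    intro i
    have : b⁻¹ * a * b = a ^ r := by rw [mul_assoc, h, inv_mul_cancel_left]
    have h2 : b⁻¹ * a ^ i * b = a ^ (r * i) := by
      rw [zpow_mul, ← this]
      simpa using (conj_zpow (i := i) (a := b⁻¹) (b := a)).symm
    rw [← h2]; group
  induction k with
  | zero => simp
  | succ k ih =>
    rw [pow_succ, ← mul_assoc, ih, mul_assoc, h1, ← mul_assoc]
    congr 2
    ring

/-- This computes the order of the new generator when `b` is replaced by `b * a ^ i`. -/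
theorem mul_zpow_pow_of_mul_eq {a b : G} {r : ℤ} (h : a * b = b * a ^ r) (i : ℤ) (k : ℕ) :
    (b * a ^ i) ^ k = b ^ k * a ^ (i * ∑ j ∈ Finset.range k, r ^ j) := by
  induction k with
  | zero => simp
  | succ k ih =>
    have := zpow_mul_pow_of_mul_eq h (i * ∑ j ∈ Finset.range k, r ^ j) 1
    rw [pow_one, pow_one] at this
    rw [pow_succ, ih, mul_assoc, ← mul_assoc (a ^ _) b, this, mul_assoc b, ← zpow_add, ← mul_assoc,
      ← pow_succ, geom_sum_succ]
    congr 2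
    ring

theorem exists_zpow_mul_zpow_of_closure {x y : G} {r : ℤ} (h : x * y = y * x ^ r)
    (hy : IsOfFinOrder y) (hgen : Subgroup.closure {x, y} = ⊤) (g : G) :
    ∃ i j : ℤ, g = y ^ j * x ^ i := by
  have hg : g ∈ Subgroup.closure {x, y} := hgen ▸ Subgroup.mem_top g
  have hpow : ∀ (i j : ℤ) (k : ℕ), ∃ i' j' : ℤ, y ^ j * x ^ i * y ^ k = y ^ j' * x ^ i' := by
    intro i j k
    refine ⟨r ^ k * i, j + k, ?_⟩
    rw [mul_assoc, zpow_mul_pow_of_mul_eq h, ← mul_assoc, zpow_add, zpow_natCast]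
  induction hg using Subgroup.closure_induction_right with
  | one => exact ⟨0, 0, by simp⟩
  | mul_right g _ z hz ih =>
    obtain ⟨i, j, rfl⟩ := ih
    rcases hz with rfl | rfl
    · exact ⟨i + 1, j, by rw [zpow_add, zpow_one, mul_assoc]⟩
    · obtain ⟨i', j', h'⟩ := hpow i j 1
      exact ⟨i', j', by rw [← h', pow_one]⟩
  | mul_inv_cancel g _ z hz ih =>
    obtain ⟨i, j, rfl⟩ := ih
    rcases hz with rfl | rfl
    · exact ⟨i - 1, j, by rw [zpow_sub, zpow_one, mul_assoc]⟩
    -- The inverse is written as a positive power, so that no inverse of `r` as an exponent is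
    -- needed.
    · obtain ⟨i', j', h'⟩ := hpow i j (orderOf z - 1)
      refine ⟨i', j', ?_⟩
      rw [← h']
      congr 1
      rw [inv_eq_iff_mul_eq_one, ← pow_succ', Nat.sub_add_cancel hy.orderOf_pos,
        pow_orderOf_eq_one]

theorem card_le_of_forall_zpow_mul_zpow {x y : G} {m n : ℕ} (hm : 0 < m) (hn : 0 < n)
    (hx : x ^ m = 1) (hy : y ^ n = 1) (h : ∀ g : G, ∃ i j : ℤ, g = y ^ j * x ^ i) :
    Finite G ∧ Nat.card G ≤ m * n := by
  have hxf : IsOfFinOrder x := isOfFinOrder_iff_pow_eq_one.2 ⟨m, hm, hx⟩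
  have hyf : IsOfFinOrder y := isOfFinOrder_iff_pow_eq_one.2 ⟨n, hn, hy⟩
  have : Finite (Subgroup.zpowers x) := hxf.finite_zpowers
  have : Finite (Subgroup.zpowers y) := hyf.finite_zpowers
  let f : Subgroup.zpowers x × Subgroup.zpowers y → G := fun u => u.2 * u.1
  have hf : Function.Surjective f := by
    intro g
    obtain ⟨i, j, rfl⟩ := h g
    exact ⟨⟨⟨x ^ i, i, rfl⟩, ⟨y ^ j, j, rfl⟩⟩, rfl⟩
  refine ⟨Finite.of_surjective f hf, (Nat.card_le_card_of_surjective f hf).trans ?_⟩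
  rw [Nat.card_prod, Nat.card_zpowers, Nat.card_zpowers]
  exact Nat.mul_le_mul (Nat.le_of_dvd hm (orderOf_dvd_of_pow_eq_one hx))
    (Nat.le_of_dvd hn (orderOf_dvd_of_pow_eq_one hy))

/-- A subgroup properly above `⟨x⟩` contains some `y ^ j` with `q ∤ j`; with `y ^ q ∈ ⟨x⟩` it
contains `y`. The second maximal subgroup is one above `⟨y⟩`. -/
theorem hasCyclicMaximalSubgroup_of_generators [Finite G] {x y : G} {p k q : ℕ} (hp : p.Prime)
    (hq : q.Prime) (hx : x ^ p ^ k = 1) (h : ∀ g : G, ∃ i j : ℤ, g = y ^ j * x ^ i)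
    (hyq : y ^ q ∈ Subgroup.zpowers x) (hyx : y ∉ Subgroup.zpowers x) (hy : Subgroup.zpowers y ≠ ⊤) :
    HasCyclicMaximalSubgroup G := by
  obtain ⟨l, -, hl⟩ := (Nat.dvd_prime_pow hp).1 (orderOf_dvd_of_pow_eq_one hx)
  obtain ⟨M, hM, hyM⟩ := (eq_top_or_exists_le_coatom _).resolve_left hy
  refine ⟨x, p, l, hp, hl, ?_, ⟨?_, ?_⟩, M, hM, ?_⟩
  · rintro rfl
    refine hy (eq_top_iff.2 fun g _ => ?_)
    obtain ⟨i, j, rfl⟩ := h g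
    simp
  · intro ht
    exact hyx (ht ▸ Subgroup.mem_top y)
  · intro K hK
    obtain ⟨g, hgK, hgx⟩ := SetLike.exists_of_lt hK
    have hxK : x ∈ K := hK.le (Subgroup.mem_zpowers x)
    obtain ⟨i, j, rfl⟩ := h g
    have hyj : y ^ j ∈ K := (K.mul_mem_cancel_right (K.zpow_mem hxK i)).1 hgK
    have hqj : ¬ (q : ℤ) ∣ j := by
      rintro ⟨c, rfl⟩
      apply hgx
      rw [zpow_mul, zpow_natCast]
      exact Subgroup.mul_mem _ (Subgroup.zpow_mem _ hyq c)
        (Subgroup.zpow_mem_zpowers _ _)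
    have hcop : IsCoprime (j : ℤ) q :=
      ((Nat.prime_iff_prime_int.1 hq).coprime_iff_not_dvd.2 hqj).symm
    obtain ⟨u, v, huv⟩ := hcop
    have hyK : y ∈ K := by
      have : y = (y ^ j) ^ u * (y ^ q) ^ v := by
        conv_lhs => rw [← zpow_one y, ← huv, zpow_add, mul_comm u, zpow_mul, mul_comm v, zpow_mul,
          zpow_natCast]
      rw [this]
      exact K.mul_mem (K.zpow_mem hyj u) (K.zpow_mem (hK.le hyq) v)
    rw [eq_top_iff]
    rintro g -
    obtain ⟨i, j, rfl⟩ := h g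
    exact K.mul_mem (K.zpow_mem hyK j) (K.zpow_mem hxK i)
  · rintro rfl
    exact hyx (Subgroup.zpowers_le.1 hyM)

theorem HasCyclicMaximalSubgroup.of_mulEquiv {K : Type*} [Group K]
    (hG : HasCyclicMaximalSubgroup G) (e : G ≃* K) : HasCyclicMaximalSubgroup K := by
  obtain ⟨h, p, k, hp, hk, h1, hc, M, hM, hne⟩ := hG
  have hmap : (Subgroup.zpowers h).map (e : G →* K) = Subgroup.zpowers (e h) :=
    MonoidHom.map_zpowers _ _
  have hiso : ∀ N : Subgroup G, IsCoatom N → IsCoatom (N.map (e : G →* K)) := fun N hN =>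
    (e.mapSubgroup.isCoatom_iff N).2 hN
  refine ⟨e h, p, k, hp, ?_, ?_, ?_, M.map (e : G →* K), hiso M hM, ?_⟩
  · rw [MulEquiv.orderOf_eq, hk]
  · simpa using h1
  · rw [← hmap]; exact hiso _ hc
  · rw [← hmap]
    exact fun heq => hne (Subgroup.map_injective e.injective heq)

theorem notMem_zpowers_of_map {K : Type*} [Group K] {x y : G} (f : G →* K) (hx : f x = 1)
    (hy : f y ≠ 1) : y ∉ Subgroup.zpowers x := by
  rintro ⟨i, rfl⟩
  simp [hx] at hy

theorem zpowers_ne_top_of_orderOf_lt [Finite G] {y : G} (h : orderOf y < Nat.card G) :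
    Subgroup.zpowers y ≠ ⊤ := by
  intro ht
  rw [← Nat.card_zpowers, ht, Subgroup.card_top] at h
  exact lt_irrefl _ h

end Generators

/-! ### The listed groups have a suitable cyclic maximal subgroup. -/

section Families

theorem hasCyclicMaximalSubgroup_zmod_prod {p q k : ℕ} (hp : p.Prime) (hq : q.Prime) (hk : k ≠ 0) :
    HasCyclicMaximalSubgroup (Multiplicative (ZMod (p ^ k) × ZMod q)) := by
  have : NeZero (p ^ k) := ⟨pow_ne_zero _ hp.ne_zero⟩
  have : NeZero q := ⟨hq.ne_zero⟩
  have : Fact (1 < q) := ⟨hq.one_lt⟩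
  have : Fact (1 < p ^ k) := ⟨Nat.one_lt_pow hk hp.one_lt⟩
  have : Finite (Multiplicative (ZMod (p ^ k) × ZMod q)) :=
    inferInstanceAs (Finite (ZMod (p ^ k) × ZMod q))
  refine hasCyclicMaximalSubgroup_of_generators (x := Multiplicative.ofAdd (1, 0))
    (y := Multiplicative.ofAdd (0, 1)) (k := k) hp hq ?_ ?_ ?_ ?_ ?_
  · rw [← ofAdd_nsmul, ofAdd_eq_one]
    ext <;> simp
  · intro g
    refine ⟨(g.toAdd.1.cast : ℤ), (g.toAdd.2.cast : ℤ), ?_⟩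
    rw [← ofAdd_zsmul, ← ofAdd_zsmul, ← ofAdd_add]
    apply Multiplicative.toAdd.injective
    ext <;> simp
  · have : (Multiplicative.ofAdd ((0, 1) : ZMod (p ^ k) × ZMod q)) ^ q = 1 := by
      rw [← ofAdd_nsmul, ofAdd_eq_one]
      ext <;> simp
    rw [this]; exact one_mem _
  · refine notMem_zpowers_of_map (AddMonoidHom.snd (ZMod (p ^ k)) (ZMod q)).toMultiplicative ?_ ?_
    · rfl
    · intro h
      exact one_ne_zero (α := ZMod q) (ofAdd_eq_one.1 h)
  · intro ht
    refine notMem_zpowers_of_map (y := Multiplicative.ofAdd ((1, 0) : ZMod (p ^ k) × ZMod q))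
      (AddMonoidHom.fst (ZMod (p ^ k)) (ZMod q)).toMultiplicative ?_ ?_ (ht ▸ Subgroup.mem_top _)
    · rfl
    · intro h
      exact one_ne_zero (α := ZMod (p ^ k)) (ofAdd_eq_one.1 h)

theorem hasCyclicMaximalSubgroup_zmod_mul {p q k : ℕ} (hp : p.Prime) (hq : q.Prime) (hpq : p ≠ q)
    (hk : k ≠ 0) : HasCyclicMaximalSubgroup (Multiplicative (ZMod (p ^ k * q))) :=
  (hasCyclicMaximalSubgroup_zmod_prod hp hq hk).of_mulEquiv
    (ZMod.chineseRemainder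
      (Nat.Coprime.pow_left k ((Nat.coprime_primes hp hq).2 hpq))).symm.toAddEquiv.toMultiplicative

theorem hasCyclicMaximalSubgroup_dihedral {k : ℕ} (hk : 2 ≤ k) :
    HasCyclicMaximalSubgroup (DihedralGroup (2 ^ k)) := by
  have hpow : 2 ^ 2 ≤ 2 ^ k := Nat.pow_le_pow_right two_pos hk
  refine hasCyclicMaximalSubgroup_of_generators (x := DihedralGroup.r 1) (y := DihedralGroup.sr 0)
    (k := k) Nat.prime_two Nat.prime_two DihedralGroup.r_one_pow_n ?_ ?_ ?_ ?_
  · rintro (i | i)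
    · exact ⟨(i.cast : ℤ), 0, by simp⟩
    · exact ⟨(i.cast : ℤ), 1, by simp⟩
  · rw [pow_two, DihedralGroup.sr_mul_self]; exact one_mem _
  · rintro ⟨i, hi⟩
    simp at hi
  · apply zpowers_ne_top_of_orderOf_lt
    rw [DihedralGroup.orderOf_sr, DihedralGroup.nat_card]
    omega

theorem hasCyclicMaximalSubgroup_quaternion {k : ℕ} (hk : 1 ≤ k) :
    HasCyclicMaximalSubgroup (QuaternionGroup (2 ^ k)) := by
  have hpow : 2 ^ 1 ≤ 2 ^ k := Nat.pow_le_pow_right two_pos hk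
  refine hasCyclicMaximalSubgroup_of_generators (x := QuaternionGroup.a 1)
    (y := QuaternionGroup.xa 0) (k := k + 1) Nat.prime_two Nat.prime_two ?_ ?_ ?_ ?_ ?_
  · rw [pow_succ']; exact QuaternionGroup.a_one_pow_n
  · rintro (i | i)
    · refine ⟨(i.val : ℤ), 0, ?_⟩
      rw [zpow_natCast, QuaternionGroup.a_one_pow]; simp
    · refine ⟨(i.val : ℤ), 1, ?_⟩
      rw [zpow_natCast, QuaternionGroup.a_one_pow]; simp
  · rw [QuaternionGroup.xa_sq, ← QuaternionGroup.a_one_pow]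
    exact Subgroup.npow_mem_zpowers _ _
  · rw [mem_zpowers_iff_mem_range_orderOf]
    intro h
    obtain ⟨i, -, hi⟩ := Finset.mem_image.1 h
    simp at hi
  · apply zpowers_ne_top_of_orderOf_lt
    rw [QuaternionGroup.orderOf_xa, Nat.card_eq_fintype_card, QuaternionGroup.card]
    omega

theorem ModularPGroup.relations (p n : ℕ) :
    (PresentedGroup.of 0 : ModularPGroup p n) ^ p ^ (n - 1) = 1 ∧
    (PresentedGroup.of 1 : ModularPGroup p n) ^ p = 1 ∧
    (PresentedGroup.of 0 : ModularPGroup p n) * PresentedGroup.of 1 =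
      PresentedGroup.of 1 * PresentedGroup.of 0 ^ ((1 + p ^ (n - 2) : ℕ) : ℤ) := by
  refine ⟨?_, ?_, ?_⟩
  · exact PresentedGroup.one_of_mem (Or.inl rfl)
  · exact PresentedGroup.one_of_mem (Or.inr (Or.inl rfl))
  · have h := PresentedGroup.mk_eq_mk_of_mul_inv_mem
      (rels := ({FreeGroup.of 0 ^ p ^ (n - 1), FreeGroup.of 1 ^ p,
        (FreeGroup.of 1)⁻¹ * FreeGroup.of 0 * FreeGroup.of 1 *
        (FreeGroup.of 0 ^ (1 + p ^ (n - 2)))⁻¹} : Set (FreeGroup (Fin 2)))) (Or.inr (Or.inr rfl))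
    rw [map_mul, map_mul, map_inv, map_pow] at h
    rw [zpow_natCast, ← inv_mul_eq_iff_eq_mul, ← mul_assoc]
    exact h

theorem SemidihedralGroup.relations (n : ℕ) :
    (PresentedGroup.of 0 : SemidihedralGroup n) ^ 2 ^ (n - 1) = 1 ∧
    (PresentedGroup.of 1 : SemidihedralGroup n) ^ 2 = 1 ∧
    (PresentedGroup.of 0 : SemidihedralGroup n) * PresentedGroup.of 1 =
      PresentedGroup.of 1 * PresentedGroup.of 0 ^ (-1 + 2 ^ (n - 2) : ℤ) := by
  have h2 : (PresentedGroup.of 1 : SemidihedralGroup n) ^ 2 = 1 :=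
    PresentedGroup.one_of_mem (Or.inr (Or.inl rfl))
  refine ⟨PresentedGroup.one_of_mem (Or.inl rfl), h2, ?_⟩
  have h := PresentedGroup.mk_eq_mk_of_mul_inv_mem
      (rels := ({FreeGroup.of 0 ^ 2 ^ (n - 1), FreeGroup.of 1 ^ 2,
        FreeGroup.of 1 * FreeGroup.of 0 * FreeGroup.of 1 *
        (FreeGroup.of 0 ^ (-1 + 2 ^ (n - 2) : ℤ))⁻¹} : Set (FreeGroup (Fin 2))))
      (Or.inr (Or.inr rfl))
  rw [map_mul, map_mul, map_zpow] at h
  have hinv : (PresentedGroup.of 1 : SemidihedralGroup n)⁻¹ = PresentedGroup.of 1 :=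
    inv_eq_of_mul_eq_one_left (by rw [← pow_two, h2])
  refine Eq.trans ?_ (congrArg (PresentedGroup.of 1 * ·) h)
  change _ = PresentedGroup.of 1 * (PresentedGroup.of 1 * PresentedGroup.of 0 * PresentedGroup.of 1)
  rw [← mul_assoc, ← mul_assoc, ← pow_two, h2, one_mul]

theorem PresentedGroup.closure_pair_of (rels : Set (FreeGroup (Fin 2))) :
    Subgroup.closure {(PresentedGroup.of 0 : PresentedGroup rels), PresentedGroup.of 1} = ⊤ := by
  rw [← PresentedGroup.closure_range_of rels]
  congr 1
  ext g
  simp [Fin.exists_fin_two, eq_comm]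

theorem ModularPGroup.exists_zpow_mul_zpow {p n : ℕ} (hp : p ≠ 0) (g : ModularPGroup p n) :
    ∃ i j : ℤ, g = PresentedGroup.of 1 ^ j * PresentedGroup.of 0 ^ i := by
  obtain ⟨-, h2, h3⟩ := ModularPGroup.relations p n
  exact exists_zpow_mul_zpow_of_closure h3
    (isOfFinOrder_iff_pow_eq_one.2 ⟨p, Nat.pos_of_ne_zero hp, h2⟩)
    (PresentedGroup.closure_pair_of _) g

theorem SemidihedralGroup.exists_zpow_mul_zpow {n : ℕ} (g : SemidihedralGroup n) :
    ∃ i j : ℤ, g = PresentedGroup.of 1 ^ j * PresentedGroup.of 0 ^ i := by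
  obtain ⟨-, h2, h3⟩ := SemidihedralGroup.relations n
  exact exists_zpow_mul_zpow_of_closure h3
    (isOfFinOrder_iff_pow_eq_one.2 ⟨2, two_pos, h2⟩)
    (PresentedGroup.closure_pair_of _) g

theorem ModularPGroup.finite_and_card_le {p n : ℕ} (hp : p ≠ 0) :
    Finite (ModularPGroup p n) ∧ Nat.card (ModularPGroup p n) ≤ p ^ (n - 1) * p := by
  obtain ⟨h1, h2, -⟩ := ModularPGroup.relations p n
  exact card_le_of_forall_zpow_mul_zpow (pow_pos (Nat.pos_of_ne_zero hp) _)
    (Nat.pos_of_ne_zero hp) h1 h2 (ModularPGroup.exists_zpow_mul_zpow hp)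

theorem SemidihedralGroup.finite_and_card_le (n : ℕ) :
    Finite (SemidihedralGroup n) ∧ Nat.card (SemidihedralGroup n) ≤ 2 ^ (n - 1) * 2 := by
  obtain ⟨h1, h2, -⟩ := SemidihedralGroup.relations n
  exact card_le_of_forall_zpow_mul_zpow (by positivity) two_pos h1 h2
    SemidihedralGroup.exists_zpow_mul_zpow

/-- The homomorphism from the modular `p`-group to an abelian group of exponent `p` with prescribed
values on the generators. -/
def ModularPGroup.lift {p n : ℕ} (hn : 3 ≤ n) {A : Type*} [CommGroup A] (hA : ∀ u : A, u ^ p = 1)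
    (f : Fin 2 → A) : ModularPGroup p n →* A :=
  PresentedGroup.toGroup (f := f) <| by
    have hpow : ∀ u : A, ∀ k, k ≠ 0 → u ^ p ^ k = 1 := fun u k hk => by
      obtain ⟨l, rfl⟩ := Nat.exists_eq_succ_of_ne_zero hk
      rw [pow_succ', pow_mul, hA, one_pow]
    rintro r (rfl | rfl | rfl)
    · rw [map_pow, hpow _ _ (by omega)]
    · rw [map_pow, hA]
    · simp only [map_mul, map_inv, map_pow, FreeGroup.lift_apply_of, pow_add, pow_one]
      rw [hpow _ _ (by omega)]
      simp

/-- The homomorphism from the semidihedral group to an abelian group of exponent two with prescribed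
values on the generators. -/
def SemidihedralGroup.lift {n : ℕ} (hn : 3 ≤ n) {A : Type*} [CommGroup A] (hA : ∀ u : A, u ^ 2 = 1)
    (f : Fin 2 → A) : SemidihedralGroup n →* A :=
  PresentedGroup.toGroup (f := f) <| by
    have hpow : ∀ u : A, ∀ k, k ≠ 0 → u ^ 2 ^ k = 1 := fun u k hk => by
      obtain ⟨l, rfl⟩ := Nat.exists_eq_succ_of_ne_zero hk
      rw [pow_succ', pow_mul, hA, one_pow]
    have hpow' : ∀ u : A, u ^ (2 ^ (n - 2) : ℤ) = 1 := fun u => by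
      have := hpow u (n - 2) (by omega)
      rw [← zpow_natCast] at this
      simpa using this
    rintro r (rfl | rfl | rfl)
    · rw [map_pow, hpow _ _ (by omega)]
    · rw [map_pow, hA]
    · simp only [map_mul, map_inv, map_zpow, FreeGroup.lift_apply_of, zpow_add, hpow', mul_one,
        zpow_neg_one, inv_inv]
      rw [mul_assoc (f 1 * f 0), ← pow_two, hA]

/-- Two homomorphisms to `ZMod p`, each killing one generator and not the other, separate the
generators; the exact order of the presented group is not needed. -/
theorem hasCyclicMaximalSubgroup_modular {p n : ℕ} (hp : p.Prime) (hn : 3 ≤ n) :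
    HasCyclicMaximalSubgroup (ModularPGroup p n) := by
  have := (ModularPGroup.finite_and_card_le (n := n) hp.ne_zero).1
  have : Fact (1 < p) := ⟨hp.one_lt⟩
  obtain ⟨h1, h2, -⟩ := ModularPGroup.relations p n
  have hA : ∀ u : Multiplicative (ZMod p), u ^ p = 1 := fun u => by
    apply Multiplicative.toAdd.injective; simp
  have hne : Multiplicative.ofAdd (1 : ZMod p) ≠ 1 := fun h =>
    one_ne_zero (α := ZMod p) (ofAdd_eq_one.1 h)
  refine hasCyclicMaximalSubgroup_of_generators (x := PresentedGroup.of 0)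
    (y := PresentedGroup.of 1) hp hp h1 (ModularPGroup.exists_zpow_mul_zpow hp.ne_zero)
    (h2 ▸ one_mem _) ?_ ?_
  · exact notMem_zpowers_of_map (ModularPGroup.lift hn hA ![1, Multiplicative.ofAdd 1])
      (PresentedGroup.toGroup.of _) ((PresentedGroup.toGroup.of _).trans_ne hne)
  · intro ht
    exact notMem_zpowers_of_map (ModularPGroup.lift hn hA ![Multiplicative.ofAdd 1, 1])
      (PresentedGroup.toGroup.of _) ((PresentedGroup.toGroup.of (x := 0) _).trans_ne hne)
      (ht ▸ Subgroup.mem_top _)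

theorem hasCyclicMaximalSubgroup_semidihedral {n : ℕ} (hn : 3 ≤ n) :
    HasCyclicMaximalSubgroup (SemidihedralGroup n) := by
  have := (SemidihedralGroup.finite_and_card_le n).1
  obtain ⟨h1, h2, -⟩ := SemidihedralGroup.relations n
  have hA : ∀ u : Multiplicative (ZMod 2), u ^ 2 = 1 := by decide
  have hne : Multiplicative.ofAdd (1 : ZMod 2) ≠ 1 := by decide
  refine hasCyclicMaximalSubgroup_of_generators (x := PresentedGroup.of 0)
    (y := PresentedGroup.of 1) Nat.prime_two Nat.prime_two h1
    SemidihedralGroup.exists_zpow_mul_zpow (h2 ▸ one_mem _) ?_ ?_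
  · exact notMem_zpowers_of_map (SemidihedralGroup.lift hn hA ![1, Multiplicative.ofAdd 1])
      (PresentedGroup.toGroup.of _) ((PresentedGroup.toGroup.of _).trans_ne hne)
  · intro ht
    exact notMem_zpowers_of_map (SemidihedralGroup.lift hn hA ![Multiplicative.ofAdd 1, 1])
      (PresentedGroup.toGroup.of _) ((PresentedGroup.toGroup.of (x := 0) _).trans_ne hne)
      (ht ▸ Subgroup.mem_top _)

end Families

/-! ### Congruences for the exponent `r`. -/

section Arithmetic

theorem Int.sq_dvd_one_add_pow_sub (x : ℤ) (j : ℕ) : x ^ 2 ∣ (1 + x) ^ j - (1 + j * x) := by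
  induction j with
  | zero => simp
  | succ j ih =>
    obtain ⟨c, hc⟩ := ih
    refine ⟨c * (1 + x) + j, ?_⟩
    rw [pow_succ, eq_add_of_sub_eq hc]
    push_cast
    ring

theorem Int.prime_dvd_sub_one_of_dvd_pow_sub_one {p : ℕ} (hp : p.Prime) {r : ℤ}
    (h : (p : ℤ) ∣ r ^ p - 1) : (p : ℤ) ∣ r - 1 := by
  have : Fact p.Prime := ⟨hp⟩
  rw [← ZMod.intCast_zmod_eq_zero_iff_dvd] at h ⊢
  push_cast at h ⊢
  rwa [ZMod.pow_card] at h

/-- Fermat gives `p ∣ r - 1`; lifting the exponent then shows that `r ^ p - 1` has exactly one more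
factor `p` than `r - 1`. -/
theorem Int.pow_dvd_sub_one_of_odd {p N : ℕ} (hp : p.Prime) (hodd : Odd p) {r : ℤ}
    (h : (p : ℤ) ^ (N + 1) ∣ r ^ p - 1) : (p : ℤ) ^ N ∣ r - 1 := by
  have h1 := Int.prime_dvd_sub_one_of_dvd_pow_sub_one hp ((dvd_pow_self _ N.succ_ne_zero).trans h)
  have hr : ¬ (p : ℤ) ∣ r := fun hr => by
    have := (dvd_sub_right hr).1 h1
    exact (Nat.prime_iff_prime_int.1 hp).not_dvd_one this
  have h2 := Int.emultiplicity_pow_sub_pow hp hodd h1 hr p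
  have h3 : emultiplicity p p = 1 :=
    (Nat.finiteMultiplicity_iff.2 ⟨hp.ne_one, hp.pos⟩).emultiplicity_self
  rw [one_pow] at h2
  rw [pow_dvd_iff_le_emultiplicity, h2, h3, Nat.cast_add, Nat.cast_one] at h
  rw [pow_dvd_iff_le_emultiplicity]
  exact (ENat.add_le_add_iff_right ENat.one_ne_top).1 h

/-- With `r = 2 * s + 1`, only one of `s`, `s + 1` is even and it absorbs the whole power of two. -/
theorem Int.two_pow_dvd_of_dvd_sq_sub_one {N : ℕ} {r : ℤ} (hr : Odd r)
    (h : (2 : ℤ) ^ (N + 1) ∣ r ^ 2 - 1) : (2 : ℤ) ^ N ∣ r - 1 ∨ (2 : ℤ) ^ N ∣ r + 1 := by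
  rcases N with _ | N
  · simp
  obtain ⟨s, rfl⟩ := hr
  have h1 : (2 : ℤ) ^ N ∣ s * (s + 1) := by
    have : (2 * s + 1) ^ 2 - 1 = 2 ^ 2 * (s * (s + 1)) := by ring
    rw [this, show N + 1 + 1 = 2 + N by ring, pow_add] at h
    exact (mul_dvd_mul_iff_left (by norm_num)).1 h
  rw [show 2 * s + 1 - 1 = 2 * s by ring, show 2 * s + 1 + 1 = 2 * (s + 1) by ring, pow_succ']
  by_cases hs : (2 : ℤ) ∣ s
  · left
    exact mul_dvd_mul_left _ (Int.prime_two.pow_dvd_of_dvd_mul_right N (by omega) h1)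
  · right
    exact mul_dvd_mul_left _ (Int.prime_two.pow_dvd_of_dvd_mul_left N hs h1)

theorem Int.eq_of_two_pow_dvd_sq_sub_one {N : ℕ} (hN : 1 ≤ N) {r : ℤ}
    (h : (2 : ℤ) ^ (N + 1) ∣ r ^ 2 - 1) :
    (2 : ℤ) ^ (N + 1) ∣ r - 1 ∨ (2 : ℤ) ^ (N + 1) ∣ r - (-1) ∨
      2 ≤ N ∧ ((2 : ℤ) ^ (N + 1) ∣ r - (1 + 2 ^ N) ∨ (2 : ℤ) ^ (N + 1) ∣ r - (-1 + 2 ^ N)) := by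
  have hr : Odd r := by
    have h2 : (2 : ℤ) ∣ r ^ 2 - 1 := (dvd_pow_self _ N.succ_ne_zero).trans h
    have := Int.prime_dvd_sub_one_of_dvd_pow_sub_one Nat.prime_two h2
    rw [Int.odd_iff]; norm_cast at this; omega
  have key : ∀ e : ℤ, (2 : ℤ) ^ N ∣ r - e →
      (2 : ℤ) ^ (N + 1) ∣ r - e ∨ (2 : ℤ) ^ (N + 1) ∣ r - (e + 2 ^ N) := by
    rintro e ⟨c, hc⟩
    obtain ⟨d, rfl | rfl⟩ := Int.even_or_odd' c
    · left; exact ⟨d, by rw [hc]; ring⟩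
    · right; exact ⟨d, by rw [← sub_sub, hc]; ring⟩
  rcases hN.lt_or_eq with h2 | rfl
  · rcases Int.two_pow_dvd_of_dvd_sq_sub_one hr h with h1 | h1
    · rcases key 1 h1 with h' | h'
      · exact Or.inl h'
      · exact Or.inr (Or.inr ⟨h2, Or.inl h'⟩)
    · rcases key (-1) (by rwa [sub_neg_eq_add]) with h' | h'
      · exact Or.inr (Or.inl h')
      · exact Or.inr (Or.inr ⟨h2, Or.inr h'⟩)
  · norm_num
    obtain ⟨s, rfl⟩ := hr
    omega

/-- Modulo `p ^ (2 * N)` the `k`-th term is `1 + k * p ^ N`, and `p` divides `0 + 1 + ⋯ + (p - 1)`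
because `p` is odd. -/
theorem Int.pow_dvd_sum_one_add_pow {p N : ℕ} (hodd : Odd p) (hN : 1 ≤ N) :
    (p : ℤ) ^ (N + 1) ∣ ∑ k ∈ Finset.range p, (1 + (p : ℤ) ^ N) ^ k - p := by
  have h1 : (p : ℤ) ∣ ∑ k ∈ Finset.range p, (k : ℤ) := by
    rw [← Nat.cast_sum]
    refine Int.natCast_dvd_natCast.2 ?_
    have h2 := Finset.sum_range_id_mul_two p
    have h3 : p ∣ (∑ k ∈ Finset.range p, k) * 2 := ⟨_, h2⟩
    exact (Nat.Coprime.dvd_mul_right (Nat.coprime_two_right.2 hodd)).1 h3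
  have h4 : ∑ k ∈ Finset.range p, (1 + (p : ℤ) ^ N) ^ k - p =
      ∑ k ∈ Finset.range p, ((1 + (p : ℤ) ^ N) ^ k - (1 + k * (p : ℤ) ^ N)) +
        (∑ k ∈ Finset.range p, (k : ℤ)) * (p : ℤ) ^ N := by
    rw [Finset.sum_sub_distrib, Finset.sum_add_distrib, Finset.sum_mul]
    simp only [Finset.sum_const, Finset.card_range, nsmul_one]
    ring
  rw [h4]
  apply dvd_add
  · refine Finset.dvd_sum fun k _ => ?_
    refine dvd_trans ?_ (Int.sq_dvd_one_add_pow_sub _ k)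
    rw [← pow_mul]
    exact pow_dvd_pow _ (by omega)
  · rw [pow_succ']
    exact mul_dvd_mul_right h1 _

end Arithmetic

/-! ### Isomorphisms from generators, relations and order. -/

section Recognition

variable {G : Type*} [Group G]

theorem zpow_eq_zpow_of_dvd {a : G} {m : ℕ} (ha : a ^ m = 1) {i j : ℤ} (h : (m : ℤ) ∣ i - j) :
    a ^ i = a ^ j := by
  obtain ⟨c, hc⟩ := h
  rw [eq_add_of_sub_eq hc, zpow_add, zpow_mul, zpow_natCast, ha, one_zpow, one_mul]

theorem IsCoatom.eq_top_of_mem {a b : G} (ha : IsCoatom (Subgroup.zpowers a))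
    (hb : b ∉ Subgroup.zpowers a) {K : Subgroup G} (haK : a ∈ K) (hbK : b ∈ K) : K = ⊤ := by
  refine ha.2 K (lt_of_le_of_ne (Subgroup.zpowers_le.2 haK) ?_)
  rintro rfl
  exact hb hbK

/-- The range contains the maximal `⟨a⟩` and `b`, so `f` is onto; an upper bound on the order of `K`
then makes it bijective. -/
theorem nonempty_mulEquiv_of_card_le {K : Type*} [Group K] [Finite K] {a b : G}
    (ha : IsCoatom (Subgroup.zpowers a)) (hb : b ∉ Subgroup.zpowers a) (f : K →* G)
    (haf : a ∈ f.range) (hbf : b ∈ f.range) (hcard : Nat.card K ≤ Nat.card G) :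
    Nonempty (G ≃* K) := by
  have hf : Function.Surjective f := MonoidHom.range_eq_top.1 (ha.eq_top_of_mem hb haf hbf)
  exact ⟨(MulEquiv.ofBijective f (hf.bijective_of_nat_card_le hcard)).symm⟩

/-- The homomorphism from the cyclic group of order `m` sending the generator to `x`. -/
def zmodPowHom (m : ℕ) (x : G) (hx : x ^ m = 1) : Multiplicative (ZMod m) →* G :=
  AddMonoidHom.toMultiplicativeLeft (ZMod.lift m ⟨zmultiplesHom (Additive G) (Additive.ofMul x), by
    rw [zmultiplesHom_apply, natCast_zsmul, ← ofMul_pow, hx, ofMul_one]⟩)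

theorem zmodPowHom_intCast {m : ℕ} {x : G} (hx : x ^ m = 1) (i : ℤ) :
    zmodPowHom m x hx (Multiplicative.ofAdd (i : ZMod m)) = x ^ i := by
  simp [zmodPowHom]

theorem zmodPowHom_one {m : ℕ} {x : G} (hx : x ^ m = 1) :
    zmodPowHom m x hx (Multiplicative.ofAdd 1) = x := by
  simpa using zmodPowHom_intCast hx 1

theorem zmodPowHom_add {m : ℕ} {x : G} (hx : x ^ m = 1) (i j : ZMod m) :
    zmodPowHom m x hx (Multiplicative.ofAdd (i + j)) =
      zmodPowHom m x hx (Multiplicative.ofAdd i) * zmodPowHom m x hx (Multiplicative.ofAdd j) := by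
  rw [ofAdd_add, map_mul]

theorem zmodPowHom_mul {m : ℕ} {x b : G} (hx : x ^ m = 1) (h : x * b = b * x ^ (-1 : ℤ))
    (i : ZMod m) : zmodPowHom m x hx (Multiplicative.ofAdd i) * b =
      b * zmodPowHom m x hx (Multiplicative.ofAdd (-i)) := by
  obtain ⟨i, rfl⟩ := ZMod.intCast_surjective i
  rw [← Int.cast_neg, zmodPowHom_intCast, zmodPowHom_intCast]
  simpa using zpow_mul_pow_of_mul_eq h i 1

theorem nonempty_mulEquiv_zmod_prod {a b : G} {m q : ℕ} (hm : m ≠ 0) (hq : q ≠ 0)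
    (hcoat : IsCoatom (Subgroup.zpowers a)) (hb : b ∉ Subgroup.zpowers a) (hab : Commute a b)
    (ham : a ^ m = 1) (hbq : b ^ q = 1) (hcard : m * q ≤ Nat.card G) :
    Nonempty (G ≃* Multiplicative (ZMod m × ZMod q)) := by
  have : NeZero m := ⟨hm⟩
  have : NeZero q := ⟨hq⟩
  have : Finite (Multiplicative (ZMod m × ZMod q)) := inferInstanceAs (Finite (ZMod m × ZMod q))
  let f := ((zmodPowHom m a ham).noncommCoprod (zmodPowHom q b hbq) (by
    intro i j
    obtain ⟨i, rfl⟩ := Multiplicative.ofAdd.surjective i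
    obtain ⟨j, rfl⟩ := Multiplicative.ofAdd.surjective j
    obtain ⟨i, rfl⟩ := ZMod.intCast_surjective i
    obtain ⟨j, rfl⟩ := ZMod.intCast_surjective j
    rw [zmodPowHom_intCast, zmodPowHom_intCast]
    exact hab.zpow_zpow i j)).comp (MulEquiv.prodMultiplicative (ZMod m) (ZMod q)).toMonoidHom
  refine nonempty_mulEquiv_of_card_le hcoat hb f ⟨Multiplicative.ofAdd (1, 0), ?_⟩
    ⟨Multiplicative.ofAdd (0, 1), ?_⟩ ?_
  · exact (congrArg₂ (· * ·) (zmodPowHom_one ham) (map_one (zmodPowHom q b hbq))).trans (mul_one a)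
  · exact (congrArg₂ (· * ·) (map_one (zmodPowHom m a ham)) (zmodPowHom_one hbq)).trans (one_mul b)
  · rw [Nat.card_congr Multiplicative.toAdd, Nat.card_prod, Nat.card_zmod, Nat.card_zmod]
    exact hcard

theorem nonempty_mulEquiv_dihedral {a b : G} {m : ℕ} (hm : m ≠ 0)
    (hcoat : IsCoatom (Subgroup.zpowers a)) (hb : b ∉ Subgroup.zpowers a)
    (hab : a * b = b * a ^ (-1 : ℤ)) (ham : a ^ m = 1) (hb2 : b ^ 2 = 1)
    (hcard : 2 * m ≤ Nat.card G) : Nonempty (G ≃* DihedralGroup m) := by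
  have : NeZero m := ⟨hm⟩
  let φ : ZMod m → G := fun i => zmodPowHom m a ham (Multiplicative.ofAdd i)
  have hadd : ∀ i j, φ (i + j) = φ i * φ j := zmodPowHom_add ham
  have hmul : ∀ i, φ i * b = b * φ (-i) := zmodPowHom_mul ham hab
  have hbb : b * b = 1 := by rw [← pow_two, hb2]
  have hφ1 : φ 1 = a := zmodPowHom_one ham
  have hφ0 : φ 0 = 1 := map_one _
  let f : DihedralGroup m →* G := MonoidHom.mk' (fun g => match g with
    | .r i => φ i
    | .sr i => b * φ i) (by
      rintro (i | i) (j | j)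
      · exact hadd i j
      · change b * φ (j - i) = φ i * (b * φ j)
        rw [← mul_assoc, hmul, mul_assoc, ← hadd, sub_eq_neg_add]
      · change b * φ (i + j) = b * φ i * φ j
        rw [hadd, mul_assoc]
      · change φ (j - i) = b * φ i * (b * φ j)
        rw [mul_assoc, ← mul_assoc (φ i), hmul, mul_assoc b, ← hadd, ← mul_assoc, hbb, one_mul,
          sub_eq_neg_add])
  refine nonempty_mulEquiv_of_card_le hcoat hb f ⟨.r 1, hφ1⟩ ⟨.sr 0, ?_⟩ ?_
  · change b * φ 0 = b
    rw [hφ0, mul_one]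
  · rwa [DihedralGroup.nat_card]

theorem nonempty_mulEquiv_quaternion {a b : G} {m : ℕ} (hm : m ≠ 0)
    (hcoat : IsCoatom (Subgroup.zpowers a)) (hb : b ∉ Subgroup.zpowers a)
    (hab : a * b = b * a ^ (-1 : ℤ)) (ham : a ^ (2 * m) = 1) (hb2 : b ^ 2 = a ^ m)
    (hcard : 4 * m ≤ Nat.card G) : Nonempty (G ≃* QuaternionGroup m) := by
  have : NeZero m := ⟨hm⟩
  let φ : ZMod (2 * m) → G := fun i => zmodPowHom (2 * m) a ham (Multiplicative.ofAdd i)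
  have hadd : ∀ i j, φ (i + j) = φ i * φ j := zmodPowHom_add ham
  have hmul : ∀ i, φ i * b = b * φ (-i) := zmodPowHom_mul ham hab
  have hbb : b * b = φ m := by
    have := zmodPowHom_intCast ham m
    rw [zpow_natCast, Int.cast_natCast] at this
    rw [← pow_two, hb2]
    exact this.symm
  have hφ1 : φ 1 = a := zmodPowHom_one ham
  have hφ0 : φ 0 = 1 := map_one _
  let f : QuaternionGroup m →* G := MonoidHom.mk' (fun g => match g with
    | .a i => φ i
    | .xa i => b * φ i) (by
      rintro (i | i) (j | j)
      · exact hadd i j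
      · change b * φ (j - i) = φ i * (b * φ j)
        rw [← mul_assoc, hmul, mul_assoc, ← hadd, sub_eq_neg_add]
      · change b * φ (i + j) = b * φ i * φ j
        rw [hadd, mul_assoc]
      · change φ (m + j - i) = b * φ i * (b * φ j)
        rw [mul_assoc, ← mul_assoc (φ i), hmul, mul_assoc b, ← hadd, ← mul_assoc, hbb, ← hadd]
        congr 1
        ring)
  refine nonempty_mulEquiv_of_card_le hcoat hb f ⟨.a 1, hφ1⟩ ⟨.xa 0, ?_⟩ ?_
  · change b * φ 0 = b
    rw [hφ0, mul_one]
  · rwa [Nat.card_eq_fintype_card, QuaternionGroup.card]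

theorem nonempty_mulEquiv_modular {a b : G} {p n : ℕ} (hp : p ≠ 0)
    (hcoat : IsCoatom (Subgroup.zpowers a)) (hb : b ∉ Subgroup.zpowers a)
    (hab : a * b = b * a ^ (1 + p ^ (n - 2) : ℤ)) (ha : a ^ p ^ (n - 1) = 1) (hbp : b ^ p = 1)
    (hcard : p ^ (n - 1) * p ≤ Nat.card G) : Nonempty (G ≃* ModularPGroup p n) := by
  obtain ⟨hfin, hle⟩ := ModularPGroup.finite_and_card_le (n := n) hp
  let f : ModularPGroup p n →* G := PresentedGroup.toGroup (f := ![a, b]) (by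
    rintro r (rfl | rfl | rfl)
    · simpa using ha
    · simpa using hbp
    · simp only [map_mul, map_inv, map_pow, FreeGroup.lift_apply_of, Matrix.cons_val_zero,
        Matrix.cons_val_one]
      rw [mul_assoc b⁻¹, hab, inv_mul_cancel_left, mul_inv_eq_one, ← zpow_natCast]
      push_cast
      rfl)
  exact nonempty_mulEquiv_of_card_le hcoat hb f ⟨_, PresentedGroup.toGroup.of (x := 0) _⟩
    ⟨_, PresentedGroup.toGroup.of (x := 1) _⟩ (hle.trans hcard)

theorem nonempty_mulEquiv_semidihedral {a b : G} {n : ℕ}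
    (hcoat : IsCoatom (Subgroup.zpowers a)) (hb : b ∉ Subgroup.zpowers a)
    (hab : a * b = b * a ^ (-1 + 2 ^ (n - 2) : ℤ)) (ha : a ^ 2 ^ (n - 1) = 1) (hb2 : b ^ 2 = 1)
    (hcard : 2 ^ (n - 1) * 2 ≤ Nat.card G) : Nonempty (G ≃* SemidihedralGroup n) := by
  obtain ⟨hfin, hle⟩ := SemidihedralGroup.finite_and_card_le n
  let f : SemidihedralGroup n →* G := PresentedGroup.toGroup (f := ![a, b]) (by
    rintro r (rfl | rfl | rfl)
    · simpa using ha
    · simpa using hb2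
    · simp only [map_mul, map_inv, map_zpow, FreeGroup.lift_apply_of, Matrix.cons_val_zero,
        Matrix.cons_val_one]
      rw [mul_assoc b, hab, ← mul_assoc, ← pow_two, hb2, one_mul, mul_inv_cancel])
  exact nonempty_mulEquiv_of_card_le hcoat hb f ⟨_, PresentedGroup.toGroup.of (x := 0) _⟩
    ⟨_, PresentedGroup.toGroup.of (x := 1) _⟩ (hle.trans hcard)

end Recognition

/-! ### Classification of the groups with such a maximal subgroup. -/

section Classification

variable {G : Type*} [Group G]

theorem mul_zpow_notMem_zpowers {a b : G} (hb : b ∉ Subgroup.zpowers a) (i : ℤ) :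
    b * a ^ i ∉ Subgroup.zpowers a := by
  rwa [Subgroup.mul_mem_cancel_right _ (Subgroup.zpow_mem_zpowers a i)]

theorem mul_mul_zpow_of_mul_eq {a b : G} {r : ℤ} (h : a * b = b * a ^ r) (i : ℤ) :
    a * (b * a ^ i) = b * a ^ i * a ^ r := by
  rw [← mul_assoc, h, mul_assoc, mul_assoc, (Commute.refl a).zpow_zpow r i]

theorem mem_zpowers_of_pow_mem {K : Subgroup G} {b : G} {p : ℕ} (hp : p.Prime) {i : ℤ}
    (hi : ¬ (p : ℤ) ∣ i) (k : ℕ) (hbp : b ^ p ^ k ∈ K) (hbi : b ^ i ∈ K) : b ∈ K := by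
  obtain ⟨u, v, huv⟩ : IsCoprime i ((p : ℤ) ^ k) :=
    (((Nat.prime_iff_prime_int.1 hp).coprime_iff_not_dvd.2 hi).symm).pow_right
  have : b = (b ^ i) ^ u * (b ^ p ^ k) ^ v := by
    conv_lhs => rw [← zpow_one b, ← huv, zpow_add, mul_comm u, zpow_mul, mul_comm v, zpow_mul,
      ← Nat.cast_pow, zpow_natCast]
  rw [this]
  exact K.mul_mem (K.zpow_mem hbi u) (K.zpow_mem hbp v)

theorem nonempty_mulEquiv_modular_of_odd {a b : G} {p N : ℕ} (hp : p.Prime) (hodd : Odd p)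
    (hN : 1 ≤ N) {r m c : ℤ} (ha : a ^ p ^ (N + 1) = 1)
    (hcoat : IsCoatom (Subgroup.zpowers a)) (hb : b ∉ Subgroup.zpowers a)
    (hab : a * b = b * a ^ r) (hr : r = 1 + p ^ N * c) (hc : ¬ (p : ℤ) ∣ c)
    (hbp : b ^ p = a ^ (p * m)) (hcard : p ^ (N + 1) * p ≤ Nat.card G) :
    Nonempty (G ≃* ModularPGroup p (N + 2)) := by
  -- With `j` inverse to `c` modulo `p`, conjugation by `b ^ j` raises `a` to `(1 + p ^ N * c) ^ j ≡
  -- 1 + p ^ N`.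
  obtain ⟨j, hj⟩ : ∃ j : ℕ, (p : ℤ) ∣ c * j - 1 := by
    have : Fact p.Prime := ⟨hp⟩
    have hc' : (c : ZMod p) ≠ 0 := by rwa [Ne, ZMod.intCast_zmod_eq_zero_iff_dvd]
    refine ⟨((c : ZMod p)⁻¹).val, ?_⟩
    rw [← ZMod.intCast_zmod_eq_zero_iff_dvd]
    simp [hc']
  have hrj : ((p ^ (N + 1) : ℕ) : ℤ) ∣ r ^ j - (1 + p ^ N) := by
    have h1 := Int.sq_dvd_one_add_pow_sub ((p : ℤ) ^ N * c) j
    have h2 : (p : ℤ) ^ (N + 1) ∣ ((p : ℤ) ^ N * c) ^ 2 := by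
      rw [mul_pow, ← pow_mul]
      exact (pow_dvd_pow _ (by omega)).mul_right _
    have h3 : (p : ℤ) ^ (N + 1) ∣ (p : ℤ) ^ N * (c * j - 1) := by
      rw [pow_succ]; exact mul_dvd_mul_left _ hj
    rw [hr, Nat.cast_pow]
    have h4 := dvd_add (h2.trans h1) h3
    rwa [show (1 + (p : ℤ) ^ N * c) ^ j - (1 + j * ((p : ℤ) ^ N * c)) + (p : ℤ) ^ N * (c * j - 1) =
      (1 + (p : ℤ) ^ N * c) ^ j - (1 + (p : ℤ) ^ N) by ring] at h4
  have hab1 : a * b ^ j = b ^ j * a ^ (1 + (p : ℤ) ^ N) := by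
    have := zpow_mul_pow_of_mul_eq hab 1 j
    rwa [zpow_one, mul_one, zpow_eq_zpow_of_dvd ha hrj] at this
  have hb1 : b ^ j ∉ Subgroup.zpowers a := by
    intro hmem
    refine hb (mem_zpowers_of_pow_mem hp (i := j) (fun hpj => ?_) 1 ?_ (by rwa [zpow_natCast]))
    · exact (Nat.prime_iff_prime_int.1 hp).not_dvd_one ((dvd_sub_right (hpj.mul_left c)).1 hj)
    · rw [pow_one, hbp]; exact Subgroup.zpow_mem_zpowers _ _
  -- The geometric sum is `p` modulo `p ^ (N + 1)`, so this factor cancels `(b ^ j) ^ p = a ^ (p * m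
  -- * j)`.
  refine nonempty_mulEquiv_modular (b := b ^ j * a ^ (-(m * j))) hp.ne_zero hcoat
    (mul_zpow_notMem_zpowers hb1 _) (mul_mul_zpow_of_mul_eq hab1 _) ha ?_ hcard
  rw [mul_zpow_pow_of_mul_eq hab1, ← pow_mul, mul_comm j, pow_mul, hbp, ← zpow_natCast, ← zpow_mul,
    ← zpow_add, ← zpow_zero a]
  apply zpow_eq_zpow_of_dvd ha
  obtain ⟨d, hd⟩ := Int.pow_dvd_sum_one_add_pow hodd hN
  refine ⟨-(m * j * d), ?_⟩
  rw [eq_add_of_sub_eq hd]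
  push_cast
  ring

theorem nonempty_mulEquiv_modular_two {a b : G} {N : ℕ} (hN : 2 ≤ N) {m : ℤ}
    (ha : a ^ 2 ^ (N + 1) = 1) (hcoat : IsCoatom (Subgroup.zpowers a))
    (hb : b ∉ Subgroup.zpowers a) (hab : a * b = b * a ^ (1 + 2 ^ N : ℤ))
    (hb2 : b ^ 2 = a ^ (2 * m)) (hcard : 2 ^ (N + 1) * 2 ≤ Nat.card G) :
    Nonempty (G ≃* ModularPGroup 2 (N + 2)) := by
  obtain ⟨M, rfl⟩ := Nat.exists_eq_add_of_le' hN
  -- The square is `a ^ (2 * m + i * (2 + 2 ^ N))`, with `i` the exponent chosen here; `1 - 2 ^ (N -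
  -- 1)` inverts `1 + 2 ^ (N - 1)` modulo `2 ^ N`.
  refine nonempty_mulEquiv_modular (b := b * a ^ (-(m * (1 - 2 ^ (M + 1))))) two_ne_zero hcoat
    (mul_zpow_notMem_zpowers hb _) (mul_mul_zpow_of_mul_eq (by exact_mod_cast hab) _) ha ?_ hcard
  rw [mul_zpow_pow_of_mul_eq hab, hb2, ← zpow_add, ← zpow_zero a]
  apply zpow_eq_zpow_of_dvd ha
  refine ⟨m * 2 ^ M, ?_⟩
  rw [Finset.sum_range_succ, Finset.sum_range_one]
  push_cast
  ring

theorem nonempty_mulEquiv_semidihedral_of_mul_eq {a b : G} {N : ℕ} {c : ℤ}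
    (ha : a ^ 2 ^ (N + 1) = 1) (hcoat : IsCoatom (Subgroup.zpowers a))
    (hb : b ∉ Subgroup.zpowers a) (hab : a * b = b * a ^ (-1 + 2 ^ N : ℤ))
    (hb2 : b ^ 2 = a ^ (2 ^ N * c)) (hcard : 2 ^ (N + 1) * 2 ≤ Nat.card G) :
    Nonempty (G ≃* SemidihedralGroup (N + 2)) := by
  -- Here `1 + r = 2 ^ N`, so the exponent of the square is exactly `2 ^ N * c - c * 2 ^ N = 0`.
  refine nonempty_mulEquiv_semidihedral (b := b * a ^ (-c)) hcoat
    (mul_zpow_notMem_zpowers hb _) (mul_mul_zpow_of_mul_eq hab _) ha ?_ hcard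
  rw [mul_zpow_pow_of_mul_eq hab, hb2, ← zpow_add, ← zpow_zero a]
  congr 1
  rw [Finset.sum_range_succ, Finset.sum_range_one]
  ring

theorem nonempty_mulEquiv_dihedral_or_quaternion {a b : G} {N : ℕ} {c : ℤ}
    (ha : a ^ 2 ^ (N + 1) = 1) (hcoat : IsCoatom (Subgroup.zpowers a))
    (hb : b ∉ Subgroup.zpowers a) (hab : a * b = b * a ^ (-1 : ℤ))
    (hb2 : b ^ 2 = a ^ (2 ^ N * c)) (hcard : 2 ^ (N + 1) * 2 ≤ Nat.card G) :
    Nonempty (G ≃* DihedralGroup (2 ^ (N + 1))) ∨ Nonempty (G ≃* QuaternionGroup (2 ^ N)) := by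
  obtain ⟨d, rfl | rfl⟩ := Int.even_or_odd' c
  · left
    refine nonempty_mulEquiv_dihedral (by positivity) hcoat hb hab ha ?_ (by linarith)
    rw [hb2, ← zpow_zero a]
    exact zpow_eq_zpow_of_dvd ha ⟨d, by push_cast; ring⟩
  · right
    refine nonempty_mulEquiv_quaternion (by positivity) hcoat hb hab (by rwa [← pow_succ']) ?_
      (by rw [pow_succ] at hcard; linarith)
    rw [hb2, ← zpow_natCast]
    exact zpow_eq_zpow_of_dvd ha ⟨d, by push_cast; ring⟩

/-- A finite `p`-group with a cyclic maximal subgroup which is not itself cyclic is abelian of type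
`(p ^ N, p)`, modular, dihedral, generalized quaternion or semidihedral. -/
theorem nonempty_mulEquiv_of_isCoatom_zpowers {a b : G} {p N : ℕ} (hp : p.Prime) (hN : N ≠ 0)
    (hord : orderOf a = p ^ N) (hcard : Nat.card G = p ^ N * p)
    (hcoat : IsCoatom (Subgroup.zpowers a)) (hn : (Subgroup.zpowers a).Normal)
    (hb : b ∉ Subgroup.zpowers a) (hbp : b ^ p ∈ Subgroup.zpowers a)
    (hbt : Subgroup.zpowers b ≠ ⊤) :
    (∃ p n : ℕ, p.Prime ∧ 2 ≤ n ∧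
      Nonempty (G ≃* Multiplicative (ZMod (p ^ (n - 1)) × ZMod p))) ∨
    (∃ p n : ℕ, p.Prime ∧ 3 ≤ n ∧ (p = 2 → 4 ≤ n) ∧ Nonempty (G ≃* ModularPGroup p n)) ∨
    (∃ n : ℕ, 3 ≤ n ∧ Nonempty (G ≃* DihedralGroup (2 ^ (n - 1)))) ∨
    (∃ n : ℕ, 3 ≤ n ∧ Nonempty (G ≃* QuaternionGroup (2 ^ (n - 2)))) ∨
    (∃ n : ℕ, 4 ≤ n ∧ Nonempty (G ≃* SemidihedralGroup n)) := by
  have ha : a ^ p ^ N = 1 := by rw [← hord, pow_orderOf_eq_one]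
  have hpN : p ^ N ≠ 0 := pow_ne_zero _ hp.ne_zero
  obtain ⟨r, hr⟩ : ∃ r : ℤ, a * b = b * a ^ r := by
    have h1 : b⁻¹ * a * b⁻¹⁻¹ ∈ Subgroup.zpowers a := hn.conj_mem a (Subgroup.mem_zpowers a) _
    obtain ⟨r, hr⟩ := Subgroup.mem_zpowers_iff.1 h1
    exact ⟨r, by rw [hr]; group⟩
  obtain ⟨m, hm⟩ := Subgroup.mem_zpowers_iff.1 hbp
  have hdvd : ∀ i j : ℤ, a ^ i = a ^ j → (p : ℤ) ^ N ∣ j - i := fun i j hij => by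
    rw [zpow_eq_zpow_iff_modEq, hord, Nat.cast_pow] at hij
    exact hij.dvd
  -- `b ^ p` is a power of `a`, so it commutes with `a`; below, it also commutes with `b`.
  have hrp : (p : ℤ) ^ N ∣ r ^ p - 1 := by
    apply hdvd
    have h1 := zpow_mul_pow_of_mul_eq hr 1 p
    rw [mul_one, ← hm, (Commute.refl a).zpow_zpow 1 m] at h1
    exact mul_left_cancel h1
  have hmr : (p : ℤ) ^ N ∣ m * (r - 1) := by
    have h1 := zpow_mul_pow_of_mul_eq hr m 1
    rw [pow_one, pow_one, hm, ← pow_succ, pow_succ', ← hm] at h1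
    have h2 := hdvd _ _ (mul_left_cancel h1)
    rwa [show m * (r - 1) = r * m - m by ring]
  -- Otherwise `b ^ p` generates `⟨a⟩`, and `b` generates `G`.
  obtain ⟨l, rfl⟩ : (p : ℤ) ∣ m := by
    by_contra hpm
    refine hbt (hcoat.eq_top_of_mem hb (mem_zpowers_of_pow_mem hp hpm N ?_ ?_)
      (Subgroup.mem_zpowers b))
    · rw [ha]; exact one_mem _
    · rw [hm]; exact Subgroup.npow_mem_zpowers _ _
  by_cases hr1 : (p : ℤ) ^ N ∣ r - 1
  · left
    have hab : a * b = b * a ^ (1 : ℤ) := by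
      rw [hr, zpow_eq_zpow_of_dvd (j := 1) ha (by exact_mod_cast hr1)]
    refine ⟨p, N + 1, hp, by omega, ?_⟩
    refine nonempty_mulEquiv_zmod_prod (b := b * a ^ (-l)) hpN hp.ne_zero hcoat
      (mul_zpow_notMem_zpowers hb _) ?_ ha ?_ hcard.ge
    · simpa only [zpow_one, Commute, SemiconjBy] using mul_mul_zpow_of_mul_eq hab (-l)
    · rw [mul_zpow_pow_of_mul_eq hab, ← hm, ← zpow_add, ← zpow_zero a]
      congr 1
      simp [mul_comm]
  right
  -- From here on `a` has order `p ^ (N + 1)`.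
  obtain ⟨N, rfl⟩ := Nat.exists_eq_add_one_of_ne_zero hN
  have hN1 : 1 ≤ N := by
    rw [Nat.one_le_iff_ne_zero]
    rintro rfl
    apply hr1
    rw [zero_add, pow_one] at hrp ⊢
    exact Int.prime_dvd_sub_one_of_dvd_pow_sub_one hp hrp
  rcases hp.eq_two_or_odd' with rfl | hodd
  · have hrs : ∀ s : ℤ, (2 : ℤ) ^ (N + 1) ∣ r - s →
        a * b = b * a ^ s ∧ (2 : ℤ) ^ (N + 1) ∣ (2 * l) * (s - 1) := fun s hs => by
      refine ⟨by rw [hr, zpow_eq_zpow_of_dvd (j := s) ha (by exact_mod_cast hs)], ?_⟩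
      have : (2 * l) * (s - 1) = (2 * l) * (r - 1) - (2 * l) * (r - s) := by ring
      rw [this]
      exact dvd_sub (by exact_mod_cast hmr) (hs.mul_left _)
    -- When `r - 1` is twice an odd number, `b ^ 2` is forced into the subgroup of order two of
    -- `⟨a⟩`.
    have hl : ∀ e : ℤ, ¬ (2 : ℤ) ∣ e → (2 : ℤ) ^ (N + 1) ∣ (2 * l) * (2 * e) →
        ∃ c : ℤ, b ^ 2 = a ^ (2 ^ N * c) := fun e he h => by
      rw [show (2 * l) * (2 * e) = 2 * ((2 * l) * e) by ring, pow_succ',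
        mul_dvd_mul_iff_left two_ne_zero] at h
      obtain ⟨c, hc⟩ := Int.prime_two.pow_dvd_of_dvd_mul_right N he h
      exact ⟨c, by rw [← hm, ← hc, Nat.cast_ofNat]⟩
    rcases Int.eq_of_two_pow_dvd_sq_sub_one hN1 (by exact_mod_cast hrp) with
      h | h | ⟨hN2, h | h⟩
    · exact absurd (by exact_mod_cast h) hr1
    · obtain ⟨hab, hd⟩ := hrs _ h
      obtain ⟨c, hc⟩ := hl (-1) (by norm_num) (by convert hd using 2; norm_num)
      rcases nonempty_mulEquiv_dihedral_or_quaternion ha hcoat hb hab hc hcard.ge with h' | h'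
      · exact Or.inr (Or.inl ⟨N + 2, by omega, h'⟩)
      · exact Or.inr (Or.inr (Or.inl ⟨N + 2, by omega, h'⟩))
    · obtain ⟨hab, -⟩ := hrs _ h
      exact Or.inl ⟨2, N + 2, hp, by omega, fun _ => by omega,
        nonempty_mulEquiv_modular_two hN2 ha hcoat hb hab hm.symm hcard.ge⟩
    · obtain ⟨hab, hd⟩ := hrs _ h
      obtain ⟨c, hc⟩ := hl (-1 + 2 ^ (N - 1)) (by
          obtain ⟨M, rfl⟩ := Nat.exists_eq_add_of_le' hN2
          rw [show M + 2 - 1 = M + 1 by omega, pow_succ]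
          omega) (by
          convert hd using 2
          obtain ⟨M, rfl⟩ := Nat.exists_eq_add_of_le' hN1
          rw [Nat.add_sub_cancel]
          ring)
      exact Or.inr (Or.inr (Or.inr ⟨N + 2, by omega,
        nonempty_mulEquiv_semidihedral_of_mul_eq ha hcoat hb hab hc hcard.ge⟩))
  · left
    obtain ⟨c, hc⟩ := Int.pow_dvd_sub_one_of_odd hp hodd hrp
    refine ⟨p, N + 2, hp, by omega, ?_, nonempty_mulEquiv_modular_of_odd hp hodd hN1 ha hcoat hb hr
      (c := c) (by rw [← hc]; ring) ?_ hm.symm hcard.ge⟩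
    · rintro rfl
      exact absurd hodd (by decide)
    · rintro ⟨d, rfl⟩
      exact hr1 ⟨d, by rw [hc]; ring⟩

/-- A subgroup `⟨x⟩` of order `q` is Sylow, hence normal by nilpotency; it commutes with `⟨a⟩`, so
`a * x` has order `orderOf a * q`. -/
theorem isCyclic_of_isCoatom_zpowers_of_coprime [Finite G] [Group.IsNilpotent G] {a : G} {q : ℕ}
    (hq : q.Prime) (hcard : Nat.card G = orderOf a * q) (hcop : (orderOf a).Coprime q)
    (hn : (Subgroup.zpowers a).Normal) : IsCyclic G := by
  have : Fact q.Prime := ⟨hq⟩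
  obtain ⟨x, hx⟩ := exists_prime_orderOf_dvd_card' (G := G) q (hcard ▸ dvd_mul_left _ _)
  have hfac : Nat.card (Subgroup.zpowers x) = q ^ (Nat.card G).factorization q := by
    rw [Nat.card_zpowers, hx, hcard, Nat.factorization_mul (orderOf_pos a).ne' hq.ne_zero]
    simp [Nat.factorization_eq_zero_of_not_dvd ((Nat.Prime.coprime_iff_not_dvd hq).1 hcop.symm),
      hq.factorization_self]
  have hxn : (Subgroup.zpowers x).Normal :=
    Sylow.normal_of_normalizerCondition Group.normalizerCondition_of_isNilpotent
      (Sylow.ofCard _ hfac)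
  have hdisj : Disjoint (Subgroup.zpowers a) (Subgroup.zpowers x) :=
    Subgroup.disjoint_of_coprime_natCard (by rwa [Nat.card_zpowers, Nat.card_zpowers, hx])
  have hcomm := Subgroup.commute_of_normal_of_disjoint _ _ hn hxn hdisj a x
    (Subgroup.mem_zpowers a) (Subgroup.mem_zpowers x)
  refine isCyclic_of_orderOf_eq_card (a * x) ?_
  rw [hcomm.orderOf_mul_eq_mul_orderOf_of_coprime (by rwa [hx]), hx, hcard]

end Classification

theorem mainTheorem4 {G : Type*} [Group G] [Finite G] [Group.IsNilpotent G] :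
    ((∃ H, (deletedComaximalGraph G).IsUniversal H) ↔
      ((∃ p q : ℕ, p.Prime ∧ q.Prime ∧ p ≠ q ∧
          Nonempty (G ≃* Multiplicative (ZMod (p * q)))) ∨
       (∃ p q a : ℕ, p.Prime ∧ q.Prime ∧ p ≠ q ∧ 2 ≤ a ∧
          Nonempty (G ≃* Multiplicative (ZMod (p ^ a * q)))) ∨
       (∃ p n : ℕ, p.Prime ∧ 2 ≤ n ∧
          Nonempty (G ≃* Multiplicative (ZMod (p ^ (n - 1)) × ZMod p))) ∨
       (∃ p n : ℕ, p.Prime ∧ 3 ≤ n ∧ (p = 2 → 4 ≤ n) ∧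
          Nonempty (G ≃* ModularPGroup p n)) ∨
       (∃ n : ℕ, 3 ≤ n ∧ Nonempty (G ≃* DihedralGroup (2 ^ (n - 1)))) ∨
       (∃ n : ℕ, 3 ≤ n ∧ Nonempty (G ≃* QuaternionGroup (2 ^ (n - 2)))) ∨
       (∃ n : ℕ, 4 ≤ n ∧ Nonempty (G ≃* SemidihedralGroup n)))) ∧
    (∀ H, (deletedComaximalGraph G).IsUniversal H →
      IsCyclic H.1.1 ∧ IsCoatom H.1.1 ∧
      (∀ K : Subgroup G, IsCoatom K → K ≠ H.1.1 → H.1.1 ⊓ K = frattini G) ∧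
      intersectionNumber G = 2) := by
  refine ⟨⟨?_, ?_⟩, ?_⟩
  · rintro ⟨H, hH⟩
    obtain ⟨a, p, k, hp, hk, ha1, hcoat, M, hM, hne⟩ := hH.hasCyclicMaximalSubgroup
    have hn := hcoat.normal_of_isNilpotent
    have hq := hcoat.index_prime
    have hcard := (Subgroup.zpowers a).card_mul_index
    rw [Nat.card_zpowers, hk] at hcard
    have hk0 : k ≠ 0 := by
      rintro rfl
      exact ha1 (orderOf_eq_one_iff.1 (hk.trans (pow_zero p)))
    by_cases hpq : p = (Subgroup.zpowers a).index
    -- Taking `b` in the second maximal subgroup `M` ensures that `⟨b⟩` is proper.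
    · obtain ⟨b, hbM, hb⟩ := SetLike.not_le_iff_exists.1 fun hle =>
        hne ((hM.le_iff_eq hcoat.1).1 hle).symm
      refine Or.inr (Or.inr (nonempty_mulEquiv_of_isCoatom_zpowers hp hk0 hk ?_ hcoat hn hb ?_ ?_))
      · rw [← hcard, ← hpq]
      · have := (Subgroup.zpowers a).pow_index_mem b
        rwa [← hpq] at this
      · exact ne_top_of_le_ne_top hM.1 (Subgroup.zpowers_le.2 hbM)
    · have hcyc := isCyclic_of_isCoatom_zpowers_of_coprime hq (by rw [← hcard, hk])
        (hk ▸ Nat.Coprime.pow_left k ((Nat.coprime_primes hp hq).2 hpq)) hn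
      have e := (zmodCyclicMulEquiv hcyc).symm
      rw [← hcard] at e
      by_cases hk1 : k = 1
      · subst hk1
        rw [pow_one] at e
        exact Or.inl ⟨p, _, hp, hq, hpq, ⟨e⟩⟩
      · exact Or.inr (Or.inl ⟨p, _, k, hp, hq, hpq, by omega, ⟨e⟩⟩)
  · intro h
    apply HasCyclicMaximalSubgroup.exists_isUniversal
    rcases h with ⟨p, q, hp, hq, hpq, ⟨e⟩⟩ | ⟨p, q, a, hp, hq, hpq, ha, ⟨e⟩⟩ | ⟨p, n, hp, hn, ⟨e⟩⟩ |
      ⟨p, n, hp, hn, -, ⟨e⟩⟩ | ⟨n, hn, ⟨e⟩⟩ | ⟨n, hn, ⟨e⟩⟩ | ⟨n, hn, ⟨e⟩⟩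
    · have := hasCyclicMaximalSubgroup_zmod_mul hp hq hpq one_ne_zero
      rw [pow_one] at this
      exact this.of_mulEquiv e.symm
    · exact (hasCyclicMaximalSubgroup_zmod_mul hp hq hpq (by omega)).of_mulEquiv e.symm
    · exact (hasCyclicMaximalSubgroup_zmod_prod hp hp (by omega)).of_mulEquiv e.symm
    · exact (hasCyclicMaximalSubgroup_modular hp hn).of_mulEquiv e.symm
    · exact (hasCyclicMaximalSubgroup_dihedral (by omega)).of_mulEquiv e.symm
    · exact (hasCyclicMaximalSubgroup_quaternion (by omega)).of_mulEquiv e.symm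
    · exact (hasCyclicMaximalSubgroup_semidihedral (by omega)).of_mulEquiv e.symm
  · intro H hH
    refine ⟨?_, hH.isCoatom_and.1, fun K hK hne => hH.inf_eq_frattini hK hne,
      hH.intersectionNumber_eq⟩
    obtain ⟨x, hx, -⟩ := hH.exists_zpowers_eq
    rw [← hx]
    infer_instance
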